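/- Let $A,B\in\mathbb{C}[X,Y]$, not both zero, let $D=A\,\partial_X+B\,\partial_Y$ be the associated nonzero derivation of $\mathbb{C}(X,Y)$, and let $\ker D=\{\varphi\in\mathbb{C}(X,Y) : D(\varphi)=0\}$ be the field of rational first integrals of $D$. For coprime $f,g\in\mathbb{C}[X,Y]$, $g\neq 0$, put $\deg(f/g)=\max(\deg f,\deg g)$ (total degrees), and define the degree of $u\in\mathbb{C}(T)$ in the same way. A rational function $\varphi\in\mathbb{C}(X,Y)$ is called decomposable if $\varphi=u(h)$ for some $u\in\mathbb{C}(T)$ with $\deg u\ge 2$ and some $h\in\mathbb{C}(X,Y)$ at which the denominator of $u$ does not vanish, and indecomposable otherwise (in particular, constants are decomposable). Then: 1. Either $\ker D=\mathbb{C}$, or $\ker D=\mathbb{C}(\varphi)$ for some indecomposable $\varphi\in\mathbb{C}(X,Y)$. 2. If $\varphi,\psi\in\ker D$ are both indecomposable, then there are $a,b,c,d\in\mathbb{C}$ with $ad-bc\neq 0$ such that $\psi=\dfrac{a\varphi+b}{c\varphi+d}$, where $c\varphi+d\neq 0$. 3. An element $\varphi\in\ker D$ is indecomposable if and only if it is nonconstant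 and has minimal degree among all nonconstant elements of $\ker D$. -/

import Mathlib

open scoped IntermediateField

namespace PlanarDerivation

/-- The polynomial ring `ℂ[X, Y]`; `X` is the variable `0` and `Y` is the variable `1`. -/
abbrev Poly : Type := MvPolynomial (Fin 2) ℂ

/-- The field `ℂ(X, Y)` of rational functions in two variables. -/
abbrev Rat2 : Type := FractionRing Poly

/-- The derivation `A ∂_X + B ∂_Y` of `ℂ[X, Y]`. -/
noncomputable def polyDer (A B : Poly) : Derivation ℂ Poly Poly :=
  A • MvPolynomial.pderiv 0 + B • MvPolynomial.pderiv 1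

/-- The extension of `D` to `ℂ(X, Y)` by the quotient rule
`D (f / g) = (g * D f - f * D g) / g ^ 2`, computed on the reduced fraction. -/
noncomputable def extendFun (D : Derivation ℂ Poly Poly) (φ : Rat2) : Rat2 :=
  algebraMap Poly Rat2
      ((IsFractionRing.den Poly φ : Poly) * D (IsFractionRing.num Poly φ)
        - IsFractionRing.num Poly φ * D (IsFractionRing.den Poly φ : Poly))
    / algebraMap Poly Rat2 (IsFractionRing.den Poly φ : Poly) ^ 2

theorem algebraMap_ne {g : Poly} (hg : g ≠ 0) : algebraMap Poly Rat2 g ≠ 0 :=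
  fun h => hg ((IsFractionRing.injective Poly Rat2) (by rw [h, map_zero]))

/-- The quotient rule holds for every representation of a rational function as a fraction. -/
theorem extendFun_div (D : Derivation ℂ Poly Poly) (f g : Poly) (hg : g ≠ 0) :
    extendFun D (algebraMap Poly Rat2 f / algebraMap Poly Rat2 g) =
      algebraMap Poly Rat2 (g * D f - f * D g) / algebraMap Poly Rat2 g ^ 2 := by
  set φ : Rat2 := algebraMap Poly Rat2 f / algebraMap Poly Rat2 g with hφ
  have hg' := algebraMap_ne hg
  have hd0 : (IsFractionRing.den Poly φ : Poly) ≠ 0 :=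
    nonZeroDivisors.ne_zero (IsFractionRing.den Poly φ).2
  have hd' := algebraMap_ne hd0
  have h1 : IsFractionRing.num Poly φ * g = f * (IsFractionRing.den Poly φ : Poly) := by
    apply IsFractionRing.injective Poly Rat2
    have := IsFractionRing.mk'_num_den' Poly φ
    rw [div_eq_iff hd'] at this
    rw [map_mul, map_mul, this, hφ]
    field_simp
  have h2 := congrArg D h1
  unfold extendFun
  generalize IsFractionRing.num Poly φ = n at *
  generalize (IsFractionRing.den Poly φ : Poly) = d at *
  rw [div_eq_div_iff (pow_ne_zero 2 hd') (pow_ne_zero 2 hg'), ← map_pow, ← map_pow,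
    ← map_mul, ← map_mul]
  congr 1
  simp only [Derivation.leibniz, smul_eq_mul] at h2
  linear_combination (d * g) * h2 - (D d * g + d * D g) * h1

theorem exists_div (φ : Rat2) :
    ∃ f g : Poly, g ≠ 0 ∧ φ = algebraMap Poly Rat2 f / algebraMap Poly Rat2 g :=
  ⟨IsFractionRing.num Poly φ, IsFractionRing.den Poly φ,
    nonZeroDivisors.ne_zero (IsFractionRing.den Poly φ).2,
    (IsFractionRing.mk'_num_den' Poly φ).symm⟩

theorem extendFun_add (D : Derivation ℂ Poly Poly) (φ ψ : Rat2) :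
    extendFun D (φ + ψ) = extendFun D φ + extendFun D ψ := by
  obtain ⟨f, g, hg, rfl⟩ := exists_div φ
  obtain ⟨a, b, hb, rfl⟩ := exists_div ψ
  have hg' := algebraMap_ne hg
  have hb' := algebraMap_ne hb
  rw [div_add_div _ _ hg' hb', ← map_mul, ← map_mul, ← map_mul, ← map_add,
    extendFun_div D _ _ (mul_ne_zero hg hb), extendFun_div D _ _ hg, extendFun_div D _ _ hb]
  simp only [Derivation.leibniz, smul_eq_mul, map_mul, map_sub, map_add]
  field_simp
  ring

theorem extendFun_mul (D : Derivation ℂ Poly Poly) (φ ψ : Rat2) :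
    extendFun D (φ * ψ) = φ * extendFun D ψ + ψ * extendFun D φ := by
  obtain ⟨f, g, hg, rfl⟩ := exists_div φ
  obtain ⟨a, b, hb, rfl⟩ := exists_div ψ
  have hg' := algebraMap_ne hg
  have hb' := algebraMap_ne hb
  rw [div_mul_div_comm, ← map_mul, ← map_mul,
    extendFun_div D _ _ (mul_ne_zero hg hb), extendFun_div D _ _ hg, extendFun_div D _ _ hb]
  simp only [Derivation.leibniz, smul_eq_mul, map_mul, map_sub, map_add]
  field_simp
  ring

theorem extendFun_algebraMap (D : Derivation ℂ Poly Poly) (f : Poly) :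
    extendFun D (algebraMap Poly Rat2 f) = algebraMap Poly Rat2 (D f) := by
  have h := extendFun_div D f 1 one_ne_zero
  simpa using h

theorem extendFun_const (D : Derivation ℂ Poly Poly) (c : ℂ) :
    extendFun D (algebraMap ℂ Rat2 c) = 0 := by
  rw [IsScalarTower.algebraMap_apply ℂ Poly Rat2, extendFun_algebraMap]
  simp

/-- The derivation `D = A ∂_X + B ∂_Y` of the field `ℂ(X, Y)`. -/
noncomputable def ratDer (A B : Poly) : Derivation ℂ Rat2 Rat2 :=
  Derivation.mk'
    { toFun := extendFun (polyDer A B)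
      map_add' := extendFun_add (polyDer A B)
      map_smul' := fun c φ => by
        rw [Algebra.smul_def, extendFun_mul, extendFun_const, RingHom.id_apply, Algebra.smul_def]
        ring }
    (fun φ ψ => extendFun_mul (polyDer A B) φ ψ)

/-- The field `ker D` of rational first integrals of `D = A ∂_X + B ∂_Y`: the rational functions
`φ` with `D φ = 0`. -/
noncomputable def firstIntegrals (A B : Poly) : IntermediateField ℂ Rat2 where
  carrier := {φ | ratDer A B φ = 0}
  mul_mem' := fun {φ ψ} hφ hψ => by
    simp only [Set.mem_ofPred_eq] at hφ hψ ⊢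
    simp [hφ, hψ]
  add_mem' := fun {φ ψ} hφ hψ => by
    simp only [Set.mem_ofPred_eq] at hφ hψ ⊢
    simp [hφ, hψ]
  algebraMap_mem' := fun c => (ratDer A B).map_algebraMap c
  inv_mem' := fun φ hφ => by
    simp only [Set.mem_ofPred_eq] at hφ ⊢
    simp [Derivation.leibniz_inv, hφ]

/-- The degree of `f / g`, with `f` and `g` coprime: the maximum of the total degrees of
`f` and `g`. -/
noncomputable def degree (φ : Rat2) : ℕ :=
  max (IsFractionRing.num Poly φ).totalDegree (IsFractionRing.den Poly φ : Poly).totalDegree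

/-- The degree of a univariate rational function: the maximum of the degrees of its coprime
numerator and denominator. -/
noncomputable def univDegree (u : RatFunc ℂ) : ℕ :=
  max u.num.natDegree u.denom.natDegree

/-- `φ` is decomposable if `φ = u(h)` for some `u ∈ ℂ(T)` of degree at least `2` and some
`h ∈ ℂ(X, Y)` (at which the denominator of `u` does not vanish). -/
def IsDecomposable (φ : Rat2) : Prop :=
  ∃ (u : RatFunc ℂ) (h : Rat2), 2 ≤ univDegree u ∧
    u.denom.eval₂ (algebraMap ℂ Rat2) h ≠ 0 ∧ φ = u.eval (algebraMap ℂ Rat2) h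

def IsIndecomposable (φ : Rat2) : Prop := ¬ IsDecomposable φ

/-- `ψ` is the image of `φ` under a homography `T ↦ (a T + b) / (c T + d)`, `a d - b c ≠ 0`. -/
def EqUpToHomography (φ ψ : Rat2) : Prop :=
  ∃ a b c d : ℂ, a * d - b * c ≠ 0 ∧
    algebraMap ℂ Rat2 c * φ + algebraMap ℂ Rat2 d ≠ 0 ∧
    ψ = (algebraMap ℂ Rat2 a * φ + algebraMap ℂ Rat2 b) /
      (algebraMap ℂ Rat2 c * φ + algebraMap ℂ Rat2 d)

end PlanarDerivation

/-! Write K = ker D. In characteristic zero a derivation kills everything algebraic over its kernel,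
so K is algebraically closed in ℂ(X, Y). Since D ≠ 0 and ℂ(X, Y) has transcendence degree 2, K is
algebraic over ℂ(φ) for every nonconstant φ in K (`isAlgebraic_adjoin_of_mem_firstIntegrals`).
Restriction to a suitable line embeds such a K into ℂ(T) (`exists_algHom_ratFunc`), and Lüroth's
theorem then gives K = ℂ(θ) (`exists_eq_adjoin`).

The rest follows from deg u(h) = deg u · deg h (`degree_eval`). A generator has minimal degree among
the nonconstant elements. An element of minimal degree is indecomposable: if φ = u(h), then h is
algebraic over K, hence lies in K, and deg u ≥ 2 would make its degree smaller. Conversely, an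
indecomposable φ = u(θ) forces deg u = 1, so φ is a homography of θ and generates K as well. -/

namespace PlanarDerivation

/-! ### Binary forms attached to coprime univariate polynomials -/

section Homogenization

variable {k R S : Type*} [Field k] [CommRing R] [Algebra k R] [CommRing S] [Algebra k S]

/-- The value at `(x, y)` of the homogenization of degree `n` of a univariate polynomial. -/
noncomputable def homEval (p : Polynomial k) (n : ℕ) (x y : R) : R :=
  ∑ i ∈ Finset.range (n + 1), algebraMap k R (p.coeff i) * x ^ i * y ^ (n - i)

theorem map_homEval (σ : R →ₐ[k] S) (p : Polynomial k) (n : ℕ) (x y : R) :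
    σ (homEval p n x y) = homEval p n (σ x) (σ y) := by
  simp [homEval, map_sum]

theorem homEval_zero_right (p : Polynomial k) (n : ℕ) (x : R) :
    homEval p n x 0 = algebraMap k R (p.coeff n) * x ^ n := by
  rw [homEval, Finset.sum_range_succ, Finset.sum_eq_zero]
  · simp
  · intro i hi
    rw [zero_pow (by have := Finset.mem_range.1 hi; omega), mul_zero]

theorem homEval_eq_pow_mul_aeval {F : Type*} [Field F] [Algebra k F] {p : Polynomial k} {n : ℕ}
    (hp : p.natDegree ≤ n) (x : F) {y : F} (hy : y ≠ 0) :
    homEval p n x y = y ^ n * Polynomial.aeval (x / y) p := by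
  rw [Polynomial.aeval_eq_sum_range' (Nat.lt_succ_of_le hp), Finset.mul_sum, homEval]
  refine Finset.sum_congr rfl fun i hi => ?_
  have hi' : i ≤ n := Nat.lt_succ_iff.1 (Finset.mem_range.1 hi)
  rw [Algebra.smul_def, div_pow, ← pow_sub_mul_pow y hi']
  field_simp

/-- Coprime forms in two variables have no common zero besides the origin. -/
theorem eq_zero_of_homEval_eq_zero [IsDomain R] {p q : Polynomial k} (hpq : IsCoprime p q)
    {x y : R} (hp : homEval p (max p.natDegree q.natDegree) x y = 0)
    (hq : homEval q (max p.natDegree q.natDegree) x y = 0) : x = 0 ∧ y = 0 := by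
  by_cases hy : y = 0
  -- At infinity only the coefficients of index n = max(deg p, deg q) survive; if x ≠ 0 both vanish,
  -- which the choice of n and coprimality exclude.
  · refine ⟨?_, hy⟩
    subst hy
    rw [homEval_zero_right] at hp hq
    by_contra hx
    have hinj := FaithfulSMul.algebraMap_injective k R
    rw [mul_eq_zero, or_iff_left (pow_ne_zero _ hx), map_eq_zero_iff _ hinj] at hp hq
    have hp0 : p = 0 ∨ p.natDegree < q.natDegree := by
      by_contra h
      push Not at h
      rw [max_eq_left h.2] at hp
      exact h.1 (Polynomial.leadingCoeff_eq_zero.1 hp)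
    have hq0 : q = 0 ∨ q.natDegree < p.natDegree := by
      by_contra h
      push Not at h
      rw [max_eq_right h.2] at hq
      exact h.1 (Polynomial.leadingCoeff_eq_zero.1 hq)
    rcases hp0 with rfl | hp0
    · rcases hq0 with rfl | hq0
      · exact not_isCoprime_zero_zero hpq
      · simp at hq0
    · rcases hq0 with rfl | hq0
      · simp at hp0
      · omega
  · exfalso
    -- Away from infinity, dehomogenize: x / y would be a common root of p and q.
    let F := FractionRing R
    let σ : R →ₐ[k] F := IsScalarTower.toAlgHom k R F
    have hσ : Function.Injective σ := IsFractionRing.injective R F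
    have hy' : σ y ≠ 0 := fun h => hy (hσ (by rw [h, map_zero]))
    have hp' := congrArg σ hp
    have hq' := congrArg σ hq
    rw [map_homEval, map_zero, homEval_eq_pow_mul_aeval (le_max_left _ _) _ hy', mul_eq_zero,
      or_iff_right (pow_ne_zero _ hy')] at hp'
    rw [map_homEval, map_zero, homEval_eq_pow_mul_aeval (le_max_right _ _) _ hy', mul_eq_zero,
      or_iff_right (pow_ne_zero _ hy')] at hq'
    obtain h | h := Polynomial.aeval_ne_zero_of_isCoprime hpq (σ x / σ y)
    exacts [h hp', h hq']

/-- Modulo a common prime factor π the two forms have a common zero in the domain R / π, so π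
divides both x and y. -/
theorem isRelPrime_homEval [IsDomain R] [UniqueFactorizationMonoid R] {p q : Polynomial k}
    (hpq : IsCoprime p q) {x y : R} (hxy : IsRelPrime x y)
    (hq : homEval q (max p.natDegree q.natDegree) x y ≠ 0) :
    IsRelPrime (homEval p (max p.natDegree q.natDegree) x y)
      (homEval q (max p.natDegree q.natDegree) x y) := by
  refine WfDvdMonoid.isRelPrime_of_no_irreducible_factors (fun h => hq h.2) fun π hπ' h1 h2 => ?_
  have hπ : Prime π := hπ'.prime
  have : (Ideal.span {π}).IsPrime := (Ideal.span_singleton_prime hπ.ne_zero).2 hπ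
  let σ : R →ₐ[k] R ⧸ Ideal.span {π} := Ideal.Quotient.mkₐ k _
  have hσ : ∀ z, σ z = 0 ↔ π ∣ z := fun z => by
    rw [← Ideal.mem_span_singleton]
    exact Ideal.Quotient.eq_zero_iff_mem
  obtain ⟨hx, hy⟩ := eq_zero_of_homEval_eq_zero hpq (x := σ x) (y := σ y)
    (by rw [← map_homEval, hσ]; exact h1) (by rw [← map_homEval, hσ]; exact h2)
  exact hπ.not_isUnit (hxy ((hσ _).1 hx) ((hσ _).1 hy))

end Homogenization

/-! ### Leading forms and total degree -/

section LeadingForms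

open MvPolynomial

variable {σ k : Type*} [Field k]

/-- The substitution `X i ↦ X i * T`. -/
noncomputable def scaleHom : MvPolynomial σ k →ₐ[k] Polynomial (MvPolynomial σ k) :=
  aeval fun i => Polynomial.C (X i) * Polynomial.X

theorem scaleHom_monomial (s : σ →₀ ℕ) (c : k) :
    scaleHom (monomial s c) = Polynomial.C (monomial s c) * Polynomial.X ^ s.degree := by
  rw [scaleHom, aeval_monomial, monomial_eq, Finsupp.prod]
  simp only [mul_pow, Finset.prod_mul_distrib, Finset.prod_pow_eq_pow_sum, map_mul, map_prod,
    map_pow, Finsupp.prod, Finsupp.degree]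
  rw [mul_assoc]
  rfl

/-- Turns top homogeneous components of products and powers into top coefficients of univariate
polynomials. -/
theorem coeff_scaleHom (f : MvPolynomial σ k) (n : ℕ) :
    (scaleHom f).coeff n = homogeneousComponent n f := by
  induction f using MvPolynomial.induction_on' with
  | monomial s c =>
    rw [scaleHom_monomial, Polynomial.coeff_C_mul_X_pow,
      homogeneousComponent_of_mem (isHomogeneous_monomial c rfl)]
  | add p q hp hq => simp [hp, hq]

theorem natDegree_scaleHom_le (f : MvPolynomial σ k) : (scaleHom f).natDegree ≤ f.totalDegree :=
  Polynomial.natDegree_le_iff_coeff_eq_zero.2 fun n hn => by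
    rw [coeff_scaleHom, homogeneousComponent_eq_zero _ _ hn]

theorem homogeneousComponent_totalDegree_ne_zero {f : MvPolynomial σ k} (hf : f ≠ 0) :
    homogeneousComponent f.totalDegree f ≠ 0 := by
  obtain ⟨s, hs, h⟩ := Finset.exists_mem_eq_sup f.support (support_nonempty.2 hf)
    fun s => s.sum fun _ e => e
  intro h0
  have h1 := congrArg (coeff s) h0
  rw [coeff_homogeneousComponent, if_pos (show s.degree = f.totalDegree from h.symm),
    coeff_zero] at h1
  exact mem_support_iff.1 hs h1

theorem totalDegree_homEval_le (p : Polynomial k) (n : ℕ) {f g : MvPolynomial σ k} {d : ℕ}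
    (hf : f.totalDegree ≤ d) (hg : g.totalDegree ≤ d) :
    (homEval p n f g).totalDegree ≤ n * d := by
  refine totalDegree_finsetSum_le fun i hi => ?_
  have hi' : i ≤ n := Nat.lt_succ_iff.1 (Finset.mem_range.1 hi)
  calc _ ≤ (0 + i * d) + (n - i) * d := by
        refine (totalDegree_mul _ _).trans (add_le_add ((totalDegree_mul _ _).trans
          (add_le_add (by rw [MvPolynomial.algebraMap_eq, totalDegree_C]) ?_)) ?_)
        · exact (totalDegree_pow _ _).trans (Nat.mul_le_mul_left _ hf)
        · exact (totalDegree_pow _ _).trans (Nat.mul_le_mul_left _ hg)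
    _ = n * d := by rw [zero_add, ← add_mul, Nat.add_sub_cancel' hi']

theorem homogeneousComponent_homEval (p : Polynomial k) (n : ℕ) {f g : MvPolynomial σ k} {d : ℕ}
    (hf : f.totalDegree ≤ d) (hg : g.totalDegree ≤ d) :
    homogeneousComponent (n * d) (homEval p n f g) =
      homEval p n (homogeneousComponent d f) (homogeneousComponent d g) := by
  have hf' := (natDegree_scaleHom_le f).trans hf
  have hg' := (natDegree_scaleHom_le g).trans hg
  rw [← coeff_scaleHom, map_homEval, homEval, homEval, Polynomial.finsetSum_coeff]
  refine Finset.sum_congr rfl fun i hi => ?_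
  have hi' : i ≤ n := Nat.lt_succ_iff.1 (Finset.mem_range.1 hi)
  have hn : n * d = i * d + (n - i) * d := by rw [← add_mul, Nat.add_sub_cancel' hi']
  rw [mul_assoc, mul_assoc, ← Algebra.smul_def, ← Algebra.smul_def, Polynomial.coeff_smul, hn,
    Polynomial.coeff_mul_add_eq_of_natDegree_le
      (Polynomial.natDegree_pow_le_of_le _ hf') (Polynomial.natDegree_pow_le_of_le _ hg'),
    Polynomial.coeff_pow_of_natDegree_le hf', Polynomial.coeff_pow_of_natDegree_le hg',
    coeff_scaleHom, coeff_scaleHom]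

/-- If both degrees dropped, the degree-d components of f and g would be a common zero of two
coprime forms, so both would vanish; but one of them is a leading form. -/
theorem max_totalDegree_homEval {p q : Polynomial k} (hpq : IsCoprime p q)
    {f g : MvPolynomial σ k} (hg : g ≠ 0) :
    max (homEval p (max p.natDegree q.natDegree) f g).totalDegree
        (homEval q (max p.natDegree q.natDegree) f g).totalDegree =
      max p.natDegree q.natDegree * max f.totalDegree g.totalDegree := by
  set n := max p.natDegree q.natDegree with hn
  set d := max f.totalDegree g.totalDegree with hd
  have hf' : f.totalDegree ≤ d := le_max_left _ _
  have hg' : g.totalDegree ≤ d := le_max_right _ _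
  refine le_antisymm (max_le (totalDegree_homEval_le p n hf' hg')
    (totalDegree_homEval_le q n hf' hg')) ?_
  by_contra! hlt
  rw [max_lt_iff] at hlt
  have hp0 := homogeneousComponent_eq_zero _ _ hlt.1
  have hq0 := homogeneousComponent_eq_zero _ _ hlt.2
  rw [homogeneousComponent_homEval _ _ hf' hg'] at hp0 hq0
  obtain ⟨h1, h2⟩ := eq_zero_of_homEval_eq_zero hpq hp0 hq0
  rcases le_total f.totalDegree g.totalDegree with h | h
  · rw [hd, max_eq_right h] at h2
    exact homogeneousComponent_totalDegree_ne_zero hg h2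
  · rw [hd, max_eq_left h] at h1
    -- The zero polynomial has total degree 0 by convention, so here d = 0 and the contradiction
    -- comes from g.
    by_cases hf : f = 0
    · subst hf
      have h0 : g.totalDegree = 0 := by simpa using h
      rw [hd, h0, totalDegree_zero, max_self] at h2
      exact homogeneousComponent_totalDegree_ne_zero hg (by rw [h0, h2])
    · exact homogeneousComponent_totalDegree_ne_zero hf h1

end LeadingForms

/-! ### Multiplicativity of the degree under composition -/

section Degree

theorem degree_div {f g : Poly} (hg : g ≠ 0) (hfg : IsRelPrime f g) :
    degree (algebraMap Poly Rat2 f / algebraMap Poly Rat2 g) =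
      max f.totalDegree g.totalDegree := by
  have hdeg : ∀ {a b : Poly}, Associated a b → a.totalDegree = b.totalDegree := by
    intro a b hab
    by_cases ha : a = 0
    · rw [ha, (hab.eq_zero_iff.1 ha)]
    · exact le_antisymm (MvPolynomial.totalDegree_le_of_dvd_of_isDomain hab.dvd
        (mt hab.eq_zero_iff.2 ha)) (MvPolynomial.totalDegree_le_of_dvd_of_isDomain hab.symm.dvd ha)
  obtain ⟨h1, h2⟩ := IsFractionRing.num_den_unique Poly
    (algebraMap Poly Rat2 f / algebraMap Poly Rat2 g) f ⟨g, mem_nonZeroDivisors_of_ne_zero hg⟩ hfg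
    (by rw [IsFractionRing.mk'_eq_div])
  rw [degree, hdeg h1, hdeg h2]

theorem exists_div_isRelPrime (φ : Rat2) :
    ∃ f g : Poly, g ≠ 0 ∧ IsRelPrime f g ∧ φ = algebraMap Poly Rat2 f / algebraMap Poly Rat2 g :=
  ⟨IsFractionRing.num Poly φ, IsFractionRing.den Poly φ,
    nonZeroDivisors.ne_zero (IsFractionRing.den Poly φ).2, IsFractionRing.num_den_reduced Poly φ,
    (IsFractionRing.mk'_num_den' Poly φ).symm⟩

/-- Homogenizing u at a reduced fraction f / g yields a fraction that is again reduced, with no drop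
in degree. -/
theorem degree_eval (u : RatFunc ℂ) (h : Rat2)
    (hu : u.denom.eval₂ (algebraMap ℂ Rat2) h ≠ 0) :
    degree (u.eval (algebraMap ℂ Rat2) h) = univDegree u * degree h := by
  obtain ⟨f, g, hg, hfg, rfl⟩ := exists_div_isRelPrime h
  have hg' := algebraMap_ne hg
  have hcop := u.isCoprime_num_denom
  let σ : Poly →ₐ[ℂ] Rat2 := IsScalarTower.toAlgHom ℂ Poly Rat2
  have key : ∀ p : Polynomial ℂ, p.natDegree ≤ univDegree u →
      algebraMap Poly Rat2 (homEval p (univDegree u) f g) = algebraMap Poly Rat2 g ^ univDegree u *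
        p.eval₂ (algebraMap ℂ Rat2) (algebraMap Poly Rat2 f / algebraMap Poly Rat2 g) :=
    fun p hp => (map_homEval σ p _ f g).trans (homEval_eq_pow_mul_aeval hp _ hg')
  have hP := key u.num (le_max_left _ _)
  have hQ := key u.denom (le_max_right _ _)
  have hQ0 : homEval u.denom (univDegree u) f g ≠ 0 := by
    intro h0
    rw [h0, map_zero] at hQ
    exact mul_ne_zero (pow_ne_zero _ hg') hu hQ.symm
  have heval : u.eval (algebraMap ℂ Rat2) (algebraMap Poly Rat2 f / algebraMap Poly Rat2 g) =
      algebraMap Poly Rat2 (homEval u.num (univDegree u) f g) /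
        algebraMap Poly Rat2 (homEval u.denom (univDegree u) f g) := by
    rw [hP, hQ, mul_div_mul_left _ _ (pow_ne_zero _ hg'), RatFunc.eval]
  have hrel : IsRelPrime (homEval u.num (univDegree u) f g)
    (homEval u.denom (univDegree u) f g) := isRelPrime_homEval hcop hfg hQ0
  rw [heval, degree_div hQ0 hrel, degree_div hg hfg]
  exact max_totalDegree_homEval hcop hg

theorem degree_eq_zero_iff (φ : Rat2) :
    degree φ = 0 ↔ φ ∈ Set.range (algebraMap ℂ Rat2) := by
  constructor
  · intro h
    obtain ⟨f, g, hg, hfg, rfl⟩ := exists_div_isRelPrime φ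
    rw [degree_div hg hfg, Nat.max_eq_zero_iff, MvPolynomial.totalDegree_eq_zero_iff_eq_C,
      MvPolynomial.totalDegree_eq_zero_iff_eq_C] at h
    refine ⟨f.coeff 0 / g.coeff 0, ?_⟩
    rw [h.1, h.2, map_div₀, IsScalarTower.algebraMap_apply ℂ Poly Rat2,
      IsScalarTower.algebraMap_apply ℂ Poly Rat2]
    simp [MvPolynomial.algebraMap_eq]
  · rintro ⟨c, rfl⟩
    have := degree_div (f := MvPolynomial.C c) (g := 1) one_ne_zero isRelPrime_one_right
    simpa [IsScalarTower.algebraMap_apply ℂ Poly Rat2, MvPolynomial.algebraMap_eq] using this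

theorem eval_mem_range_of_univDegree_eq_zero {u : RatFunc ℂ} (hu : univDegree u = 0) (h : Rat2) :
    u.eval (algebraMap ℂ Rat2) h ∈ Set.range (algebraMap ℂ Rat2) := by
  obtain ⟨c, rfl⟩ := (RatFunc.eq_C_iff u).2 (Nat.max_eq_zero_iff.1 hu)
  exact ⟨c, by simp⟩

theorem transcendental_of_notMem_range {φ : Rat2} (hφ : φ ∉ Set.range (algebraMap ℂ Rat2)) :
    Transcendental ℂ φ := fun h => hφ <| by
  have : Algebra.IsAlgebraic ℂ ℂ⟮φ⟯ := IntermediateField.isAlgebraic_adjoin_simple h.isIntegral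
  have hmem := IntermediateField.mem_adjoin_simple_self ℂ φ
  rw [IntermediateField.eq_bot_of_isAlgClosed_of_isAlgebraic ℂ⟮φ⟯] at hmem
  exact IntermediateField.mem_bot.1 hmem

theorem isDecomposable_of_mem_range {φ : Rat2} (hφ : φ ∈ Set.range (algebraMap ℂ Rat2)) :
    IsDecomposable φ := by
  obtain ⟨c, rfl⟩ := hφ
  let p : Polynomial ℂ := Polynomial.X ^ 2 + Polynomial.C c
  have hp : univDegree (algebraMap (Polynomial ℂ) (RatFunc ℂ) p) = 2 := by
    rw [univDegree, RatFunc.num_algebraMap, RatFunc.denom_algebraMap,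
      Polynomial.natDegree_X_pow_add_C]
    simp
  refine ⟨algebraMap (Polynomial ℂ) (RatFunc ℂ) p, 0, hp.ge, ?_, ?_⟩
  · rw [RatFunc.denom_algebraMap]
    simp
  · rw [RatFunc.eval_algebraMap]
    simp [p]

theorem exists_eval_of_mem_adjoin {φ ψ : Rat2} (hφ : Transcendental ℂ φ) (hψ : ψ ∈ ℂ⟮φ⟯) :
    ∃ u : RatFunc ℂ, u.denom.eval₂ (algebraMap ℂ Rat2) φ ≠ 0 ∧
      ψ = u.eval (algebraMap ℂ Rat2) φ := by
  refine ⟨(RatFunc.algEquivOfTranscendental φ hφ).symm ⟨ψ, hψ⟩,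
    fun h => hφ ⟨_, RatFunc.denom_ne_zero _, h⟩, ?_⟩
  have h := congrArg Subtype.val
    ((RatFunc.algEquivOfTranscendental φ hφ).apply_symm_apply ⟨ψ, hψ⟩)
  rw [RatFunc.algEquivOfTranscendental_apply] at h
  exact h.symm

end Degree

/-! ### Algebraic closedness and transcendence degree of ker D -/

section Algebraic

/-- The elements of a field extension killed by a derivation are algebraically closed in it. -/
theorem _root_.Derivation.eq_zero_of_isAlgebraic {k F : Type*} [Field k] [CharZero k] [Field F]
    [Algebra k F] (D : Derivation k F F) (K : IntermediateField k F) (hK : ∀ x ∈ K, D x = 0)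
    {x : F} (hx : IsAlgebraic K x) : D x = 0 := by
  let D' : Derivation K F F := Derivation.mk'
    { toFun := D
      map_add' := map_add D
      map_smul' := fun c y => by
        have hc : D (algebraMap K F c) = 0 := hK _ c.2
        rw [Algebra.smul_def, D.leibniz, hc, smul_zero, add_zero, RingHom.id_apply, smul_eq_mul,
          Algebra.smul_def] }
    (fun y z => D.leibniz y z)
  have : CharZero K := charZero_of_injective_algebraMap (algebraMap k K).injective
  -- Differentiating m(x) = 0, with m the minimal polynomial, gives m'(x) · D x = 0, and m'(x) ≠ 0
  -- by separability.
  have h := D'.map_aeval (minpoly K x) x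
  rw [minpoly.aeval, map_zero, smul_eq_mul, eq_comm, mul_eq_zero] at h
  refine h.resolve_left fun h0 => ?_
  exact (minpoly.irreducible hx.isIntegral).separable.aeval_derivative_ne_zero
    (minpoly.aeval K x) h0

theorem ratDer_algebraMap (A B f : Poly) :
    ratDer A B (algebraMap Poly Rat2 f) = algebraMap Poly Rat2 (polyDer A B f) :=
  extendFun_algebraMap (polyDer A B) f

theorem firstIntegrals_ne_top {A B : Poly} (hD : A ≠ 0 ∨ B ≠ 0) : firstIntegrals A B ≠ ⊤ := by
  intro h
  have key : ∀ f : Poly, polyDer A B f = 0 := fun f => by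
    have hf : ratDer A B (algebraMap Poly Rat2 f) = 0 :=
      show algebraMap Poly Rat2 f ∈ firstIntegrals A B from h ▸ IntermediateField.mem_top
    rw [ratDer_algebraMap] at hf
    exact (map_eq_zero_iff _ (IsFractionRing.injective Poly Rat2)).1 hf
  have h0 := key (MvPolynomial.X 0)
  have h1 := key (MvPolynomial.X 1)
  simp [polyDer, MvPolynomial.pderiv_X] at h0 h1
  exact hD.elim (fun h => h h0) (fun h => h h1)

theorem mem_firstIntegrals_of_isAlgebraic {A B : Poly} {ψ : Rat2}
    (hψ : IsAlgebraic (firstIntegrals A B) ψ) : ψ ∈ firstIntegrals A B :=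
  (ratDer A B).eq_zero_of_isAlgebraic (firstIntegrals A B) (fun _ h => h) hψ

theorem trdeg_rat2 : Algebra.trdeg ℂ Rat2 = 2 := by
  have : Algebra.IsAlgebraic Poly Rat2 := IsLocalization.isAlgebraic Rat2 (nonZeroDivisors Poly)
  have h := (IsTranscendenceBasis.mvPolynomial (Fin 2) ℂ).algebraMap_comp (A := Rat2)
  simpa using h.cardinalMk_eq_trdeg.symm

/-- Otherwise φ and ψ form a transcendence basis, ℂ(X, Y) is algebraic over ker D, and D = 0. -/
theorem isAlgebraic_adjoin_of_mem_firstIntegrals {A B : Poly} (hD : A ≠ 0 ∨ B ≠ 0)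
    {φ ψ : Rat2} (hφ : φ ∈ firstIntegrals A B) (hφt : Transcendental ℂ φ)
    (hψ : ψ ∈ firstIntegrals A B) : IsAlgebraic ℂ⟮φ⟯ ψ := by
  by_contra hcon
  have hx : AlgebraicIndependent ℂ fun _ : Unit => φ :=
    algebraicIndependent_unique_type_iff.2 hφt
  have hy : Transcendental (Algebra.adjoin ℂ (Set.range fun _ : Unit => φ)) ψ := by
    rw [Set.range_const]
    exact fun h => hcon (IntermediateField.isAlgebraic_adjoin_iff.2 h)
  have hxy := (hx.option_iff_transcendental ψ).2 hy
  have hbasis := hxy.isTranscendenceBasis_of_trdeg_le_of_finite (by rw [trdeg_rat2]; simp)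
  have halg := hbasis.isAlgebraic_field
  have hle : IntermediateField.adjoin ℂ
      (Set.range fun o : Option Unit => o.elim ψ fun _ => φ) ≤ firstIntegrals A B := by
    rw [IntermediateField.adjoin_le_iff]
    rintro _ ⟨o, rfl⟩
    cases o
    exacts [hψ, hφ]
  refine firstIntegrals_ne_top hD (eq_top_iff.2 fun z _ => mem_firstIntegrals_of_isAlgebraic ?_)
  let _ := (IntermediateField.inclusion hle).toRingHom.toAlgebra
  have : IsScalarTower (IntermediateField.adjoin ℂ
      (Set.range fun o : Option Unit => o.elim ψ fun _ => φ)) (firstIntegrals A B) Rat2 :=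
    IsScalarTower.of_algebraMap_eq fun _ => rfl
  exact (halg.isAlgebraic z).tower_top _

end Algebraic

/-! ### Restriction to a line and Lüroth's theorem -/

section Restriction

/-- A nonconstant rational function stays defined and nonconstant on the restriction to some
line. -/
theorem exists_line {f g : Poly} (hg : g ≠ 0)
    (hfg : algebraMap Poly Rat2 f / algebraMap Poly Rat2 g ∉ Set.range (algebraMap ℂ Rat2)) :
    ∃ σ : Poly →ₐ[ℂ] Polynomial ℂ, σ g ≠ 0 ∧ ∀ c : ℂ, σ f ≠ Polynomial.C c * σ g := by
  have hex : ∀ p : Poly, p ≠ 0 → ∃ P : Fin 2 → ℂ, MvPolynomial.eval P p ≠ 0 := fun p hp => by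
    by_contra! h
    exact hp (MvPolynomial.funext fun x => by rw [h, map_zero])
  obtain ⟨P, hP⟩ := hex g hg
  set c := MvPolynomial.eval P f / MvPolynomial.eval P g with hc
  have hne : f - MvPolynomial.C c * g ≠ 0 := fun h => hfg ⟨c, by
    rw [eq_div_iff (algebraMap_ne hg), sub_eq_zero.1 h, map_mul,
      IsScalarTower.algebraMap_apply ℂ Poly Rat2, MvPolynomial.algebraMap_eq]⟩
  -- f / g takes the value c at P and another value at Q, so it is not constant on the line PQ,
  -- parametrized with P at 0 and Q at 1.
  obtain ⟨Q, hQ⟩ := hex _ (mul_ne_zero hg hne)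
  rw [map_mul, map_sub, map_mul, MvPolynomial.eval_C] at hQ
  let σ : Poly →ₐ[ℂ] Polynomial ℂ := MvPolynomial.aeval fun i =>
    Polynomial.C (P i) + Polynomial.X * Polynomial.C (Q i - P i)
  have hσ : ∀ (t : ℂ) (p : Poly), (σ p).eval t =
      MvPolynomial.eval (fun i => P i + t * (Q i - P i)) p := fun t p => by
    have h : (Polynomial.aeval t).comp σ =
        MvPolynomial.aeval (fun i => P i + t * (Q i - P i)) := by
      ext i
      simp [σ]
    exact DFunLike.congr_fun h p
  have hσ0 : ∀ p, (σ p).eval 0 = MvPolynomial.eval P p := fun p => by simp [hσ]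
  have hσ1 : ∀ p, (σ p).eval 1 = MvPolynomial.eval Q p := fun p => by simp [hσ]
  refine ⟨σ, fun h => hP (by rw [← hσ0, h, Polynomial.eval_zero]), fun d hd => ?_⟩
  have h0 := congrArg (Polynomial.eval 0) hd
  have h1 := congrArg (Polynomial.eval 1) hd
  rw [Polynomial.eval_mul, Polynomial.eval_C, hσ0, hσ0] at h0
  rw [Polynomial.eval_mul, Polynomial.eval_C, hσ1, hσ1] at h1
  have hcd : c = d := by rw [hc, h0, mul_div_cancel_right₀ _ hP]
  exact hQ (by rw [h1, hcd, sub_self, mul_zero])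

/-- Let `F` be the fraction field of an integrally closed `k`-algebra `R`. A place `σ` of `R` that
is defined and transcendental at some `φ ∈ F` embeds each intermediate field of `F` that is
algebraic over `k(φ)`. -/
theorem exists_algHom_of_isAlgebraic {k R F L : Type*} [Field k] [CommRing R] [IsDomain R]
    [IsIntegrallyClosed R] [Algebra k R] [Field F] [Algebra R F] [IsFractionRing R F] [Algebra k F]
    [IsScalarTower k R F] [Field L] [Algebra k L] (σ : R →ₐ[k] L) {f g : R} (hg : σ g ≠ 0)
    (ht : Transcendental k (σ f / σ g)) (K : IntermediateField k F)
    (hK : ∀ ψ ∈ K, IsAlgebraic k⟮algebraMap R F f / algebraMap R F g⟯ ψ) :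
    Nonempty (K →ₐ[k] L) := by
  set φ := algebraMap R F f / algebraMap R F g with hφ
  have hinj := IsFractionRing.injective R F
  have hg0 : g ≠ 0 := fun h => hg (by rw [h, map_zero])
  -- O is the local ring of R at ker σ: it is integrally closed, and σ extends to it.
  let M : Submonoid R := (nonZeroDivisors L).comap σ
  have hM : ∀ p, p ∈ M ↔ σ p ≠ 0 := fun p => mem_nonZeroDivisors_iff_ne_zero
  have hM0 : M ≤ nonZeroDivisors R := fun p hp => mem_nonZeroDivisors_of_ne_zero fun h =>
    (hM p).1 hp (by rw [h, map_zero])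
  let O := Localization.subalgebra.ofField F M hM0
  have hO : ∀ z, z ∈ O ↔ ∃ (a s : R) (_ : s ∈ M), z = algebraMap R F a * (algebraMap R F s)⁻¹ :=
    fun z => Iff.rfl
  have hIC : IsIntegrallyClosed O := isIntegrallyClosed_of_isLocalization O M hM0
  let τ : O →+* L := IsLocalization.lift (M := M) (g := (σ : R →+* L))
    fun s => IsUnit.mk0 _ ((hM _).1 s.2)
  have hτ : ∀ p : R, τ (algebraMap R O p) = σ p := fun p => IsLocalization.lift_eq _ p
  have hmul : ∀ (z : O) (a s : R), (z : F) * algebraMap R F s = algebraMap R F a →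
      τ z * σ s = σ a := fun z a s h => by
    rw [← hτ, ← hτ, ← map_mul]
    exact congrArg τ (Subtype.ext h)
  have hinv : ∀ z : O, τ z ≠ 0 → (z : F)⁻¹ ∈ O := by
    intro z h
    obtain ⟨a, s, hs, hz⟩ := (hO z).1 z.2
    have hs0 : algebraMap R F s ≠ 0 := fun h0 =>
      nonZeroDivisors.ne_zero (hM0 hs) (hinj (by rw [h0, map_zero]))
    have ha : a ∈ M := by
      rw [hM, ← hmul z a s (by rw [hz, inv_mul_cancel_right₀ hs0])]
      exact mul_ne_zero h ((hM s).1 hs)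
    exact (hO _).2 ⟨s, a, ha, by rw [hz, mul_inv, inv_inv, mul_comm]⟩
  have hφO : φ ∈ O := (hO _).2 ⟨f, g, (hM g).2 hg, div_eq_mul_inv _ _⟩
  let OC : Subalgebra k F := O.restrictScalars k
  let τC : OC →ₐ[k] L :=
    { toRingHom := τ
      commutes' := fun c => by
        have h : algebraMap k OC c = algebraMap R O (algebraMap k R c) :=
          Subtype.ext (IsScalarTower.algebraMap_apply k R F c)
        exact (congrArg τ h).trans ((hτ _).trans (σ.commutes c)) }
  let φ' : OC := ⟨φ, hφO⟩
  have hτφ : τC φ' = σ f / σ g := by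
    rw [eq_div_iff hg]
    exact hmul ⟨φ, hφO⟩ f g
      (div_mul_cancel₀ _ fun h => hg0 (hinj (by rw [h, map_zero])))
  -- As σ(φ) is transcendental, each nonzero s(φ) has nonzero image under τ and is a unit of O.
  have hle : k⟮φ⟯.toSubalgebra ≤ OC := by
    intro z hz
    obtain ⟨r, s, rfl⟩ := (IntermediateField.mem_adjoin_simple_iff k z).1 hz
    have hmem : ∀ p : Polynomial k, Polynomial.aeval φ p = OC.val (Polynomial.aeval φ' p) :=
      fun p => Polynomial.aeval_algHom_apply OC.val φ' p
    by_cases hs : s = 0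
    · simp [hs]
    rw [div_eq_mul_inv, hmem, hmem]
    refine OC.mul_mem (Subtype.prop _) (hinv (Polynomial.aeval φ' s) fun h => ht ⟨s, hs, ?_⟩)
    rw [← hτφ, Polynomial.aeval_algHom_apply]
    exact h
  -- Elements of K are integral over k(φ) ⊆ O, hence lie in O.
  have hKO : K.toSubalgebra ≤ OC := by
    intro ψ hψ
    let j : k⟮φ⟯ →+* O := (Subalgebra.inclusion hle).toRingHom
    have hint : IsIntegral O ψ := by
      obtain ⟨p, hp, hp0⟩ := (hK ψ hψ).isIntegral
      refine ⟨p.map j, hp.map _, ?_⟩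
      rw [Polynomial.eval₂_map]
      exact hp0
    obtain ⟨y, rfl⟩ := (isIntegrallyClosed_iff F).1 hIC hint
    exact y.2
  exact ⟨τC.comp (Subalgebra.inclusion hKO)⟩

/-- An intermediate field of `ℂ(X, Y)` algebraic over a nonconstant rational function embeds
into `ℂ(T)`, by restriction to a line. -/
theorem exists_algHom_ratFunc (K : IntermediateField ℂ Rat2) {φ : Rat2}
    (hφ : φ ∉ Set.range (algebraMap ℂ Rat2)) (hK : ∀ ψ ∈ K, IsAlgebraic ℂ⟮φ⟯ ψ) :
    Nonempty (K →ₐ[ℂ] RatFunc ℂ) := by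
  obtain ⟨f, g, hg, rfl⟩ := exists_div φ
  obtain ⟨σ, hσg, hσ⟩ := exists_line hg hφ
  have hinj := RatFunc.algebraMap_injective ℂ
  let ι : Polynomial ℂ →ₐ[ℂ] RatFunc ℂ := IsScalarTower.toAlgHom ℂ _ _
  have hιg : ι (σ g) ≠ 0 := fun h => hσg (hinj (h.trans (map_zero _).symm))
  refine exists_algHom_of_isAlgebraic (ι.comp σ) (f := f) (g := g) hιg ?_ K hK
  refine RatFunc.transcendental_of_ne_C _ fun ⟨c, hc⟩ => hσ c (hinj ?_)
  rw [AlgHom.comp_apply, AlgHom.comp_apply, div_eq_iff hιg] at hc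
  rw [map_mul, RatFunc.algebraMap_C]
  exact hc

/-- Lüroth's theorem is applied to the image of K in ℂ(T), and the generator is pulled back. -/
theorem exists_eq_adjoin (K : IntermediateField ℂ Rat2) {φ : Rat2}
    (hφ : φ ∉ Set.range (algebraMap ℂ Rat2)) (hK : ∀ ψ ∈ K, IsAlgebraic ℂ⟮φ⟯ ψ) :
    ∃ θ, K = ℂ⟮θ⟯ := by
  obtain ⟨τ⟩ := exists_algHom_ratFunc K hφ hK
  obtain ⟨θ, hθ⟩ : RatFunc.Luroth.generator τ.fieldRange ∈ τ.fieldRange :=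
    RatFunc.Luroth.generator_mem
  have h1 : IntermediateField.map τ ℂ⟮θ⟯ = IntermediateField.map τ ⊤ := by
    rw [IntermediateField.adjoin_map, Set.image_singleton, ← AlgHom.fieldRange_eq_map]
    refine Eq.trans ?_ RatFunc.Luroth.eq_adjoin_generator.symm
    rw [← hθ]
    rfl
  have h2 : ℂ⟮θ⟯ = ⊤ := IntermediateField.map_injective τ h1
  refine ⟨θ, ?_⟩
  have h3 := congrArg (IntermediateField.map K.val) h2
  rw [IntermediateField.adjoin_map, Set.image_singleton, ← AlgHom.fieldRange_eq_map,
    IntermediateField.fieldRange_val] at h3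
  exact h3.symm

end Restriction

/-! ### Indecomposability, minimal degree and generators -/

section Indecomposable

theorem isAlgebraic_of_eval_mem (K : IntermediateField ℂ Rat2) {u : RatFunc ℂ} {h : Rat2}
    (hu : u.denom.eval₂ (algebraMap ℂ Rat2) h ≠ 0)
    (hmem : u.eval (algebraMap ℂ Rat2) h ∈ K)
    (hne : u.eval (algebraMap ℂ Rat2) h ∉ Set.range (algebraMap ℂ Rat2)) : IsAlgebraic K h := by
  set φ := u.eval (algebraMap ℂ Rat2) h with hφ
  refine ⟨u.num.map (algebraMap ℂ K) - Polynomial.C ⟨φ, hmem⟩ * u.denom.map (algebraMap ℂ K),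
    fun h0 => hne ?_, ?_⟩
  -- The denominator is monic, so its top index would exhibit φ as a coefficient of the numerator, a
  -- constant.
  · have hc := congrArg Subtype.val (congrArg (Polynomial.coeff · u.denom.natDegree) h0)
    simp only [Polynomial.coeff_sub, Polynomial.coeff_C_mul, Polynomial.coeff_map,
      Polynomial.coeff_natDegree, (RatFunc.monic_denom u).leadingCoeff, map_one, mul_one,
      Polynomial.coeff_zero] at hc
    exact ⟨_, sub_eq_zero.1 hc⟩
  · have hmul : u.num.eval₂ (algebraMap ℂ Rat2) h =
        φ * u.denom.eval₂ (algebraMap ℂ Rat2) h := by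
      rw [hφ, RatFunc.eval, div_mul_cancel₀ _ hu]
    rw [map_sub, map_mul, Polynomial.aeval_C, Polynomial.aeval_map_algebraMap,
      Polynomial.aeval_map_algebraMap, sub_eq_zero]
    exact hmul

theorem isIndecomposable_of_degree_minimal {A B : Poly} {φ : Rat2} (hφ : φ ∈ firstIntegrals A B)
    (hne : φ ∉ Set.range (algebraMap ℂ Rat2))
    (hmin : ∀ ψ ∈ firstIntegrals A B, ψ ∉ Set.range (algebraMap ℂ Rat2) → degree φ ≤ degree ψ) :
    IsIndecomposable φ := by
  rintro ⟨u, h, hu2, hu, rfl⟩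
  have hh : h ∈ firstIntegrals A B :=
    mem_firstIntegrals_of_isAlgebraic (isAlgebraic_of_eval_mem _ hu hφ hne)
  have hdeg := degree_eval u h hu
  have hpos : degree (u.eval (algebraMap ℂ Rat2) h) ≠ 0 := mt (degree_eq_zero_iff _).1 hne
  have hh0 : degree h ≠ 0 := fun h0 => hpos (by rw [hdeg, h0, mul_zero])
  have hle := hmin h hh (mt (degree_eq_zero_iff _).2 hh0)
  have h2 := Nat.mul_le_mul_right (degree h) hu2
  omega

theorem degree_le_of_mem_adjoin {φ ψ : Rat2} (hψ : ψ ∈ ℂ⟮φ⟯)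
    (hne : ψ ∉ Set.range (algebraMap ℂ Rat2)) : degree φ ≤ degree ψ := by
  by_cases hφ : φ ∈ Set.range (algebraMap ℂ Rat2)
  · rw [(degree_eq_zero_iff φ).2 hφ]
    exact Nat.zero_le _
  obtain ⟨u, hu, rfl⟩ := exists_eval_of_mem_adjoin (transcendental_of_notMem_range hφ) hψ
  rw [degree_eval u φ hu]
  exact Nat.le_mul_of_pos_left _ (Nat.pos_of_ne_zero fun h0 =>
    hne (eval_mem_range_of_univDegree_eq_zero h0 φ))

/-- A rational function of degree `1` is a homography. -/
theorem eqUpToHomography_eval {φ : Rat2} {u : RatFunc ℂ} (hu1 : univDegree u = 1)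
    (hu : u.denom.eval₂ (algebraMap ℂ Rat2) φ ≠ 0) :
    EqUpToHomography φ (u.eval (algebraMap ℂ Rat2) φ) := by
  have hn : u.num.natDegree ≤ 1 := hu1 ▸ le_max_left _ _
  have hd : u.denom.natDegree ≤ 1 := hu1 ▸ le_max_right _ _
  have hev : ∀ p : Polynomial ℂ, p.natDegree ≤ 1 → p.eval₂ (algebraMap ℂ Rat2) φ =
      algebraMap ℂ Rat2 (p.coeff 1) * φ + algebraMap ℂ Rat2 (p.coeff 0) := fun p hp => by
    conv_lhs => rw [Polynomial.eq_X_add_C_of_natDegree_le_one hp]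
    simp
  refine ⟨u.num.coeff 1, u.num.coeff 0, u.denom.coeff 1, u.denom.coeff 0, fun h0 => ?_, ?_, ?_⟩
  · have hmax : max u.num.natDegree u.denom.natDegree = 1 := hu1
    have hz : ∀ x y : ℂ, u.num.coeff 0 * y + u.num.coeff 1 * x = 0 →
        u.denom.coeff 0 * y + u.denom.coeff 1 * x = 0 → x = 0 ∧ y = 0 := fun x y h1 h2 => by
      refine eq_zero_of_homEval_eq_zero (k := ℂ) u.isCoprime_num_denom ?_ ?_ <;>
        rw [hmax, homEval, Finset.sum_range_succ, Finset.sum_range_one]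
      · simpa using h1
      · simpa using h2
    -- A zero determinant makes each of these points a common zero of the two linear forms; then
    -- both T-coefficients vanish and u has degree 0.
    obtain ⟨-, h1⟩ := hz (-u.num.coeff 0) (u.num.coeff 1) (by ring) (by linear_combination h0)
    obtain ⟨-, h2⟩ := hz (-u.denom.coeff 0) (u.denom.coeff 1) (by linear_combination -h0) (by ring)
    have hlt : ∀ p : Polynomial ℂ, p.natDegree ≤ 1 → p.coeff 1 = 0 → p.natDegree = 0 :=
      fun p hp h => by
        rw [Polynomial.eq_X_add_C_of_natDegree_le_one hp, h]
        simp
    rw [hlt _ hn h1, hlt _ hd h2] at hmax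
    simp at hmax
  · rw [← hev _ hd]
    exact hu
  · rw [← hev _ hn, ← hev _ hd, RatFunc.eval]

theorem EqUpToHomography.mem_adjoin {φ ψ : Rat2} (h : EqUpToHomography φ ψ) : φ ∈ ℂ⟮ψ⟯ := by
  obtain ⟨a, b, c, d, hdet, hden, h⟩ := h
  rw [eq_div_iff hden] at h
  have hC : ∀ z : ℂ, algebraMap ℂ Rat2 z ∈ ℂ⟮ψ⟯ := fun z => ℂ⟮ψ⟯.algebraMap_mem z
  have hψ := IntermediateField.mem_adjoin_simple_self ℂ ψ
  have hdet' : algebraMap ℂ Rat2 a * algebraMap ℂ Rat2 d -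
      algebraMap ℂ Rat2 b * algebraMap ℂ Rat2 c ≠ 0 := by
    rw [← map_mul, ← map_mul, ← map_sub]
    exact (map_ne_zero _).2 hdet
  have hne : algebraMap ℂ Rat2 a - algebraMap ℂ Rat2 c * ψ ≠ 0 := fun h0 => by
    refine hdet' ?_
    linear_combination (algebraMap ℂ Rat2 c * φ + algebraMap ℂ Rat2 d) * h0
      + algebraMap ℂ Rat2 c * h
  have hφ : φ = (algebraMap ℂ Rat2 d * ψ - algebraMap ℂ Rat2 b) /
      (algebraMap ℂ Rat2 a - algebraMap ℂ Rat2 c * ψ) := by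
    rw [eq_div_iff hne]
    linear_combination -h
  rw [hφ]
  exact div_mem (sub_mem (mul_mem (hC d) hψ) (hC b)) (sub_mem (hC a) (mul_mem (hC c) hψ))

/-- Writing ψ = u(φ), indecomposability excludes deg u ≥ 2, and also deg u = 0 because constants are
decomposable. -/
theorem eqUpToHomography_of_mem_adjoin {φ ψ : Rat2} (hφ : φ ∉ Set.range (algebraMap ℂ Rat2))
    (hψ : ψ ∈ ℂ⟮φ⟯) (hind : IsIndecomposable ψ) : EqUpToHomography φ ψ := by
  obtain ⟨u, hu, rfl⟩ := exists_eval_of_mem_adjoin (transcendental_of_notMem_range hφ) hψ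
  refine eqUpToHomography_eval (le_antisymm ?_ (Nat.pos_of_ne_zero fun h0 => ?_)) hu
  · by_contra! h
    exact hind ⟨u, φ, h, hu, rfl⟩
  · exact hind (isDecomposable_of_mem_range (eval_mem_range_of_univDegree_eq_zero h0 φ))

theorem exists_firstIntegrals_eq_adjoin {A B : Poly} (hD : A ≠ 0 ∨ B ≠ 0) {φ : Rat2}
    (hφ : φ ∈ firstIntegrals A B) (hne : φ ∉ Set.range (algebraMap ℂ Rat2)) :
    ∃ θ, θ ∉ Set.range (algebraMap ℂ Rat2) ∧ firstIntegrals A B = ℂ⟮θ⟯ := by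
  obtain ⟨θ, hθ⟩ := exists_eq_adjoin (firstIntegrals A B) hne fun ψ hψ =>
    isAlgebraic_adjoin_of_mem_firstIntegrals hD hφ (transcendental_of_notMem_range hne) hψ
  refine ⟨θ, fun h => hne ?_, hθ⟩
  rw [hθ, IntermediateField.adjoin_simple_eq_bot_iff.2 (IntermediateField.mem_bot.2 h)] at hφ
  exact IntermediateField.mem_bot.1 hφ

/-- An indecomposable rational first integral generates the field of rational first integrals. -/
theorem IsIndecomposable.firstIntegrals_eq_adjoin {A B : Poly} (hD : A ≠ 0 ∨ B ≠ 0) {φ : Rat2}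
    (hφ : φ ∈ firstIntegrals A B) (hind : IsIndecomposable φ) : firstIntegrals A B = ℂ⟮φ⟯ := by
  have hne : φ ∉ Set.range (algebraMap ℂ Rat2) := fun h => hind (isDecomposable_of_mem_range h)
  obtain ⟨θ, hθ, hK⟩ := exists_firstIntegrals_eq_adjoin hD hφ hne
  refine le_antisymm ?_ (IntermediateField.adjoin_simple_le_iff.2 hφ)
  have h := (eqUpToHomography_of_mem_adjoin hθ (hK ▸ hφ) hind).mem_adjoin
  rw [hK]
  exact IntermediateField.adjoin_simple_le_iff.2 h

end Indecomposable

end PlanarDerivation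

theorem mainTheorem3 (A B : PlanarDerivation.Poly) (hD : A ≠ 0 ∨ B ≠ 0) :
    (PlanarDerivation.firstIntegrals A B = ⊥ ∨
      ∃ φ : PlanarDerivation.Rat2, PlanarDerivation.IsIndecomposable φ ∧
        PlanarDerivation.firstIntegrals A B = ℂ⟮φ⟯) ∧
    (∀ φ ∈ PlanarDerivation.firstIntegrals A B, ∀ ψ ∈ PlanarDerivation.firstIntegrals A B,
      PlanarDerivation.IsIndecomposable φ → PlanarDerivation.IsIndecomposable ψ →
        PlanarDerivation.EqUpToHomography φ ψ) ∧
    (∀ φ ∈ PlanarDerivation.firstIntegrals A B,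
      PlanarDerivation.IsIndecomposable φ ↔
        φ ∉ Set.range (algebraMap ℂ PlanarDerivation.Rat2) ∧
        ∀ ψ ∈ PlanarDerivation.firstIntegrals A B,
          ψ ∉ Set.range (algebraMap ℂ PlanarDerivation.Rat2) →
            PlanarDerivation.degree φ ≤ PlanarDerivation.degree ψ) := by
  have hnonconst : ∀ φ, PlanarDerivation.IsIndecomposable φ →
      φ ∉ Set.range (algebraMap ℂ PlanarDerivation.Rat2) :=
    fun φ hφ h => hφ (PlanarDerivation.isDecomposable_of_mem_range h)
  refine ⟨?_, fun φ hφ ψ hψ hφi hψi => ?_, fun φ hφ => ⟨fun hφi => ⟨hnonconst φ hφi, ?_⟩, ?_⟩⟩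
  · by_cases h : ∃ φ ∈ PlanarDerivation.firstIntegrals A B,
      φ ∉ Set.range (algebraMap ℂ PlanarDerivation.Rat2)
    · obtain ⟨φ, hφ, hne⟩ := h
      obtain ⟨θ, hθ, hK⟩ := PlanarDerivation.exists_firstIntegrals_eq_adjoin hD hφ hne
      refine Or.inr ⟨θ, PlanarDerivation.isIndecomposable_of_degree_minimal (A := A) (B := B)
        (hK ▸ IntermediateField.mem_adjoin_simple_self ℂ θ) hθ fun ψ hψ hψne => ?_, hK⟩
      exact PlanarDerivation.degree_le_of_mem_adjoin (hK ▸ hψ) hψne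
    · push Not at h
      exact Or.inl (eq_bot_iff.2 fun φ hφ => IntermediateField.mem_bot.2 (h φ hφ))
  · exact PlanarDerivation.eqUpToHomography_of_mem_adjoin (hnonconst φ hφi)
      (hφi.firstIntegrals_eq_adjoin hD hφ ▸ hψ) hψi
  · intro ψ hψ hψne
    exact PlanarDerivation.degree_le_of_mem_adjoin (hφi.firstIntegrals_eq_adjoin hD hφ ▸ hψ) hψne
  · exact fun h => PlanarDerivation.isIndecomposable_of_degree_minimal hφ h.1 h.2
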